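/- Let $T$ be a compact metric space, let $t\mapsto a_t\in\mathbb{R}^n$ be a continuous map on $T$, and let $\mathbb{R}^n$ be equipped with an arbitrary norm $\|\cdot\|$, with dual norm $\|u\|_*=\max_{\|x\|\le 1}|u'x|$. Let $C(T,\mathbb{R})$ carry the supremum norm, and consider the feasible set mapping $\mathcal{F}:C(T,\mathbb{R})\rightrightarrows\mathbb{R}^n$, $\mathcal{F}(b)=\{x\in\mathbb{R}^n : a_t'x\le b_t \text{ for all } t\in T\}$. Its global Hoffman constant $\operatorname{Hof}\mathcal{F}\in[0,+\infty]$ is the infimum of all constants $\kappa\ge 0$ such that $$d(x,\mathcal{F}(b))\le \kappa\, d(b,\mathcal{F}^{-1}(x))\quad\text{for all } x\in\mathbb{R}^n \text{ and all } b\in C(T,\mathbb{R}) \text{ with } \mathcal{F}(b)\neq\emptyset,$$ where $\mathcal{F}^{-1}(x)=\{b : x\in\mathcal{F}(b)\}$, $d(z,S)=\inf_{s\in S}\|z-s\|$ in the respective space, and $\inf\emptyset=+\infty$. Then $$\operatorname{Hof}\mathcal{F}=\sup\Big\{ d_*\big(0_n,\operatorname{conv}\{a_t : t\in J\}\big)^{-1}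 \;:\; J\subset T \text{ compact},\ 0_n\notin\operatorname{conv}\{a_t : t\in J\}\Big\},$$ as an equality in $[0,+\infty]$, where $d_*(0_n,C)=\inf_{u\in C}\|u\|_*$. The set $J=\emptyset$ is allowed and contributes $d_*(0_n,\emptyset)^{-1}=(+\infty)^{-1}=0$. -/

import Mathlib

open scoped NNReal ENNReal

/-- A norm on `ℝⁿ = (Fin n → ℝ)`: a seminorm that vanishes only at `0`. -/
structure RnNorm (n : ℕ) extends Seminorm ℝ (Fin n → ℝ) where
  eq_zero_of_map_eq_zero' : ∀ x, toFun x = 0 → x = 0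

/-- The space `ℝⁿ` equipped with the norm `N` (a copy of `Fin n → ℝ` that does not carry the
default sup norm). -/
def RnWith {n : ℕ} (_N : RnNorm n) : Type := Fin n → ℝ

namespace RnWith

variable {n : ℕ} (N : RnNorm n)

instance : AddCommGroup (RnWith N) := inferInstanceAs (AddCommGroup (Fin n → ℝ))

instance : Module ℝ (RnWith N) := inferInstanceAs (Module ℝ (Fin n → ℝ))

/-- The vector of coordinates. -/
def coords {N : RnNorm n} (x : RnWith N) : Fin n → ℝ := x

noncomputable instance : NormedAddCommGroup (RnWith N) :=
  AddGroupNorm.toNormedAddCommGroup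
    { toFun := fun x : RnWith N => N.toSeminorm x.coords
      map_zero' := map_zero N.toSeminorm
      add_le' := fun x y => map_add_le_add N.toSeminorm x.coords y.coords
      neg' := fun x => map_neg_eq_map N.toSeminorm x.coords
      eq_zero_of_map_eq_zero' := fun x hx => N.eq_zero_of_map_eq_zero' x.coords hx }

theorem norm_def {N : RnNorm n} (x : RnWith N) : ‖x‖ = N.toSeminorm x.coords := rfl

noncomputable instance : NormedSpace ℝ (RnWith N) where
  norm_smul_le c x := (map_smul_eq_mul N.toSeminorm c x.coords).le

end RnWith

/-- The dual norm `‖u‖_* = max { |u'x| : ‖x‖ ≤ 1 }` on `ℝⁿ`, as an element of `[0, ∞]`. -/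
noncomputable def dualNorm {n : ℕ} (N : RnNorm n) (u : Fin n → ℝ) : ℝ≥0∞ :=
  ⨆ x : RnWith N, ⨆ _ : ‖x‖ ≤ 1, ENNReal.ofReal |u ⬝ᵥ x.coords|

/-- The distance `d_*(v, C) = inf { ‖v - u‖_* : u ∈ C }` for the dual norm, with
`d_*(v, ∅) = ∞`. -/
noncomputable def dualDist {n : ℕ} (N : RnNorm n) (v : Fin n → ℝ) (C : Set (Fin n → ℝ)) : ℝ≥0∞ :=
  ⨅ u ∈ C, dualNorm N (v - u)

/-- `κ` is a (global) Hoffman constant for the multifunction `M : Y ⇉ X`: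
`d(x, M(y)) ≤ κ d(y, M⁻¹(x))` for all `x ∈ X` and all `y ∈ dom M`.
Here `Metric.infEDist` is the point-to-set distance, equal to `∞` for the empty set. -/
def IsHoffmanConstant {Y X : Type*} [MetricSpace Y] [MetricSpace X] (M : Y → Set X) (κ : ℝ≥0) :
    Prop :=
  ∀ x : X, ∀ y : Y, (M y).Nonempty →
    Metric.infEDist x (M y) ≤ (κ : ℝ≥0∞) * Metric.infEDist y {z : Y | x ∈ M z}

/-- The global Hoffman constant `Hof M ∈ [0, ∞]` of `M : Y ⇉ X`: the infimum of all its Hoffman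
constants (`∞` if there are none). -/
noncomputable def globalHoffman {Y X : Type*} [MetricSpace Y] [MetricSpace X] (M : Y → Set X) :
    ℝ≥0∞ :=
  ⨅ κ : ℝ≥0, ⨅ _ : IsHoffmanConstant M κ, (κ : ℝ≥0∞)

/-- The feasible set mapping `F(b) = { x ∈ ℝⁿ : a_t'x ≤ b_t, t ∈ T }`, where `C(T, ℝ)` carries the
supremum norm and `ℝⁿ` carries the norm `N`. -/
def feasibleSet {n : ℕ} (N : RnNorm n) {T : Type*} [TopologicalSpace T] (a : T → Fin n → ℝ)
    (b : C(T, ℝ)) : Set (RnWith N) :=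
  {x | ∀ t : T, a t ⬝ᵥ x.coords ≤ b t}

/-!
For a feasible right-hand side `b`, the distance from `b` to the right-hand sides which admit `x`
is the largest violation `v x` of a constraint, so a Hoffman constant `κ` says that `v` grows at
rate at least `1 / κ` away from the feasible set.

Upper bound: at an infeasible point `z`, a feasible point provides a half-space showing that `0` is
not in the convex hull of the coefficients of the most violated constraints. If `s` is smaller than
the dual distance from `0` to this hull, the minimax theorem gives a unit direction in which all
these constraints, and by compactness `v` itself, decrease at rate at least `s`. By Ekeland's
variational principle, descending at rate `s` from any `x` ends only where `v` vanishes, hence at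
distance at most `v x / s` from `x`.

Lower bound: `u ∈ conv {a_t : t ∈ J}` is a convex combination of finitely many `a_t`. Separating
their hull from `0` gives a feasible system which contains the constraints `a_t'x ≤ -1` for those
`t` and which `0` violates by at most `1`. Its solutions satisfy `u'x ≤ -1`, so they are at distance
at least `1 / ‖u‖_*` from `0`.

None of this uses finite dimension: the `a_t` may be functionals on a Banach space.
-/

open Filter Metric Set Topology

section Ekeland

variable {X : Type*} [MetricSpace X] {h : X → ℝ} {r : ℝ} {y z : X}

/-- The points `y` at which `h` is lower than at `z` by at least `r * dist z y`; the relation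
`y ∈ descentSet h r z` is the order behind Ekeland's variational principle. -/
def descentSet (h : X → ℝ) (r : ℝ) (z : X) : Set X := {y | h y + r * dist z y ≤ h z}

theorem self_mem_descentSet : z ∈ descentSet h r z := by simp [descentSet]

theorem descentSet_subset_of_mem (hr : 0 ≤ r) (hy : y ∈ descentSet h r z) :
    descentSet h r y ⊆ descentSet h r z := fun w hw ↦
  calc h w + r * dist z w ≤ h w + r * (dist z y + dist y w) := by gcongr; exact dist_triangle ..
    _ = h w + r * dist y w + r * dist z y := by ring
    _ ≤ h y + r * dist z y := by gcongr; exact hw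
    _ ≤ h z := hy

theorem isClosed_descentSet (hh : LowerSemicontinuous h) : IsClosed (descentSet h r z) :=
  (hh.add (by fun_prop : Continuous fun y ↦ r * dist z y).lowerSemicontinuous).isClosed_preimage
    (h z)

theorem exists_mem_descentSet_forall_lt_add (hbdd : BddBelow (range h)) {ε : ℝ} (hε : 0 < ε) :
    ∃ y ∈ descentSet h r z, ∀ w ∈ descentSet h r z, h y < h w + ε := by
  obtain ⟨_, ⟨y, hy, rfl⟩, hlt⟩ :=
    Real.lt_sInf_add_pos (s := h '' descentSet h r z) ⟨_, z, self_mem_descentSet, rfl⟩ hε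
  refine ⟨y, hy, fun w hw ↦ hlt.trans_le ?_⟩
  gcongr
  exact csInf_le (hbdd.mono (image_subset_range h _)) ⟨w, hw, rfl⟩

/-- Ekeland's variational principle: `z` is the limit of points that are each nearly lowest in the
descent set of the previous one. -/
theorem exists_mem_descentSet_descentSet_eq_singleton [CompleteSpace X]
    (hh : LowerSemicontinuous h) (hbdd : BddBelow (range h)) (hr : 0 < r) (x : X) :
    ∃ z ∈ descentSet h r x, descentSet h r z = {z} := by
  choose next next_mem next_lt using fun (n : ℕ) (z : X) ↦
    exists_mem_descentSet_forall_lt_add (r := r) (z := z) hbdd (ε := (1 / 2) ^ n) (by positivity)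
  let seq : ℕ → X := Nat.rec x next
  have antitone_descentSet : Antitone fun n ↦ descentSet h r (seq n) :=
    antitone_nat_of_succ_le fun n ↦ descentSet_subset_of_mem hr.le (next_mem n (seq n))
  have dist_le (n : ℕ) {y : X} (hy : y ∈ descentSet h r (seq (n + 1))) :
      dist (seq (n + 1)) y ≤ (1 / 2) ^ n / r := by
    have hlt : h (seq (n + 1)) < h y + (1 / 2) ^ n :=
      next_lt n (seq n) y (antitone_descentSet n.le_succ hy)
    have hle : h y + r * dist (seq (n + 1)) y ≤ h (seq (n + 1)) := hy
    rw [le_div_iff₀' hr]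
    linarith
  have radius_tendsto : Tendsto (fun n : ℕ ↦ (1 / 2 : ℝ) ^ n / r) atTop (𝓝 0) := by
    simpa using (tendsto_pow_atTop_nhds_zero_of_lt_one (by norm_num)
      (by norm_num : (1 / 2 : ℝ) < 1)).div_const r
  have tendsto_of_mem {y : X} (hy : ∀ n, y ∈ descentSet h r (seq n)) :
      Tendsto (fun n ↦ seq (n + 1)) atTop (𝓝 y) :=
    tendsto_iff_dist_tendsto_zero.2 <| squeeze_zero (fun _ ↦ dist_nonneg)
      (fun n ↦ dist_le n (hy (n + 1))) radius_tendsto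
  have seq_mem {n m : ℕ} (hnm : n ≤ m) : seq m ∈ descentSet h r (seq n) :=
    antitone_descentSet hnm self_mem_descentSet
  obtain ⟨z, hz⟩ : ∃ z, Tendsto (fun n ↦ seq (n + 1)) atTop (𝓝 z) :=
    cauchySeq_tendsto_of_complete <| cauchySeq_of_le_tendsto_0' _
      (fun n m hnm ↦ dist_le n (seq_mem (Nat.succ_le_succ hnm))) radius_tendsto
  have z_mem (n : ℕ) : z ∈ descentSet h r (seq n) :=
    (isClosed_descentSet hh).mem_of_tendsto hz <|
      (eventually_ge_atTop n).mono fun m hm ↦ seq_mem (hm.trans m.le_succ)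
  refine ⟨z, z_mem 0, eq_singleton_iff_unique_mem.2 ⟨self_mem_descentSet, fun y hy ↦ ?_⟩⟩
  exact tendsto_nhds_unique
    (tendsto_of_mem fun n ↦ descentSet_subset_of_mem hr.le (z_mem n) hy) hz

theorem exists_mem_descentSet_eq_zero [CompleteSpace X] (hh : LowerSemicontinuous h)
    (hnonneg : ∀ z, 0 ≤ h z) (hr : 0 < r)
    (hdescent : ∀ z, 0 < h z → ∃ y ≠ z, y ∈ descentSet h r z) (x : X) :
    ∃ z ∈ descentSet h r x, h z = 0 := by
  obtain ⟨z, hzx, hz⟩ := exists_mem_descentSet_descentSet_eq_singleton hh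
    ⟨0, forall_mem_range.2 hnonneg⟩ hr x
  refine ⟨z, hzx, (hnonneg z).eq_of_not_lt' fun hpos ↦ ?_⟩
  obtain ⟨y, hyz, hy⟩ := hdescent z hpos
  exact hyz (by simpa [hz] using hy)

end Ekeland

section Separation

variable {E : Type*} [NormedAddCommGroup E] [NormedSpace ℝ E]

theorem exists_norm_le_one_lt_apply_of_lt_norm (u : StrongDual ℝ E) {r : ℝ} (hr : r < ‖u‖) :
    ∃ w : E, ‖w‖ ≤ 1 ∧ r < u w := by
  obtain ⟨w, hw, hlt⟩ := u.exists_lt_apply_of_lt_opNorm hr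
  obtain hpos | hneg := lt_abs.1 hlt
  · exact ⟨w, hw.le, hpos⟩
  · exact ⟨-w, (norm_neg w).trans_le hw.le, by simpa using hneg⟩

theorem exists_norm_le_one_forall_lt_apply {C : Set (StrongDual ℝ E)} (hC : IsCompact C)
    (hconv : Convex ℝ C) {r s : ℝ} (hrs : r < s) (hs : ∀ u ∈ C, s < ‖u‖) :
    ∃ w : E, ‖w‖ ≤ 1 ∧ ∀ u ∈ C, r < u w := by
  obtain rfl | hne := C.eq_empty_or_nonempty
  · exact ⟨0, by simp⟩
  -- Minimax needs infima and suprema of arbitrary sets of values, hence `EReal`.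
  let pairing : StrongDual ℝ E → E → EReal := fun u w ↦ (u w : ℝ)
  have monotone_coe : Monotone Real.toEReal := EReal.coe_strictMono.monotone
  have minimax : ⨅ u ∈ C, ⨆ w ∈ closedBall (0 : E) 1, pairing u w =
      ⨆ w ∈ closedBall (0 : E) 1, ⨅ u ∈ C, pairing u w :=
    Sion.minimax' hne hconv hC
      (fun w _ ↦ (continuous_coe_real_ereal.comp
        (ContinuousLinearMap.apply ℝ ℝ w).continuous).lowerSemicontinuous.lowerSemicontinuousOn C)
      (fun w _ ↦ ((ContinuousLinearMap.apply ℝ ℝ w).toLinearMap.convexOn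
        hconv).quasiconvexOn.monotone_comp (g := Real.toEReal) monotone_coe)
      (convex_closedBall 0 1)
      (fun u _ ↦ (continuous_coe_real_ereal.comp
        u.continuous).upperSemicontinuous.upperSemicontinuousOn _)
      (fun u _ ↦ (u.toLinearMap.concaveOn
        (convex_closedBall 0 1)).quasiconcaveOn.monotone_comp (g := Real.toEReal) monotone_coe)
  have le_sup (u) (hu : u ∈ C) : (s : EReal) ≤ ⨆ w ∈ closedBall (0 : E) 1, pairing u w := by
    obtain ⟨w, hw, hlt⟩ := exists_norm_le_one_lt_apply_of_lt_norm u (hs u hu)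
    exact le_iSup₂_of_le w (mem_closedBall_zero_iff.2 hw) (monotone_coe hlt.le)
  have lt_sup_inf : (r : EReal) < ⨆ w ∈ closedBall (0 : E) 1, ⨅ u ∈ C, pairing u w :=
    minimax ▸ (EReal.coe_lt_coe_iff.2 hrs).trans_le (le_iInf₂ le_sup)
  obtain ⟨w, hw, hlt⟩ : ∃ w ∈ closedBall (0 : E) 1, (r : EReal) < ⨅ u ∈ C, pairing u w := by
    simpa only [lt_iSup_iff, exists_prop] using lt_sup_inf
  exact ⟨w, mem_closedBall_zero_iff.1 hw,
    fun u hu ↦ EReal.coe_lt_coe_iff.1 (hlt.trans_le (iInf₂_le u hu))⟩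

theorem exists_norm_le_one_forall_lt_apply_of_convexHull {S : Set (StrongDual ℝ E)}
    (hS : IsCompact S) {r s : ℝ} (hrs : r < s) (hs : ∀ u ∈ convexHull ℝ S, s ≤ ‖u‖) :
    ∃ w : E, ‖w‖ ≤ 1 ∧ ∀ u ∈ S, r < u w := by
  obtain ⟨t, hrt, hts⟩ := exists_between hrs
  have le_norm : closure (convexHull ℝ S) ⊆ {u | s ≤ ‖u‖} :=
    closure_minimal hs (isClosed_le continuous_const continuous_norm)
  obtain ⟨w, hw, hlt⟩ := exists_norm_le_one_forall_lt_apply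
    (hS.totallyBounded.convexHull.closure.isCompact_of_isClosed isClosed_closure)
    (convex_convexHull ℝ S).closure hrt fun u hu ↦ hts.trans_le (le_norm hu)
  exact ⟨w, hw, fun u hu ↦ hlt u (subset_closure (subset_convexHull ℝ S hu))⟩

theorem exists_forall_apply_le_neg_one {S : Set (StrongDual ℝ E)} (hS : S.Finite)
    (h0 : 0 ∉ convexHull ℝ S) : ∃ d : E, ∀ u ∈ S, u d ≤ -1 := by
  obtain rfl | hne := S.eq_empty_or_nonempty
  · exact ⟨0, by simp⟩
  have hpos : 0 < infDist 0 (convexHull ℝ S) :=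
    ((hS.isCompact_convexHull ℝ).isClosed.notMem_iff_infDist_pos hne.convexHull).1 h0
  obtain ⟨w, -, hw⟩ := exists_norm_le_one_forall_lt_apply_of_convexHull hS.isCompact
    (half_lt_self hpos) fun u hu ↦ (infDist_le_dist_of_mem hu).trans_eq (dist_zero_left u)
  refine ⟨-(infDist 0 (convexHull ℝ S) / 2)⁻¹ • w, fun u hu ↦ ?_⟩
  rw [neg_smul, map_neg, map_smul, smul_eq_mul, neg_le_neg_iff, ← div_eq_inv_mul,
    one_le_div (half_pos hpos)]
  exact (hw u hu).le

end Separation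

theorem iInf_coe_of_le_coe (s : ℝ≥0∞) : ⨅ κ : ℝ≥0, ⨅ _ : s ≤ κ, (κ : ℝ≥0∞) = s := by
  refine le_antisymm ?_ (le_iInf fun κ ↦ le_iInf id)
  induction s using ENNReal.recTopCoe with
  | top => exact le_top
  | coe κ => exact iInf₂_le_of_le κ le_rfl le_rfl

theorem inv_infEDist_zero_le_coe_iff {E : Type*} [SeminormedAddCommGroup E] {C : Set E}
    {κ : ℝ≥0} : (infEDist 0 C)⁻¹ ≤ κ ↔ ∀ u ∈ C, 1 ≤ (κ : ℝ) * ‖u‖ := by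
  rw [ENNReal.inv_le_iff_inv_le, le_infEDist]
  refine forall₂_congr fun u _ ↦ ?_
  rw [edist_zero_left, ENNReal.inv_le_iff_le_mul (by simp) (by simp)]
  exact_mod_cast Iff.rfl

section LinearSystem

variable {E : Type*} [NormedAddCommGroup E] [NormedSpace ℝ E] {T : Type*} [TopologicalSpace T]

/-- The solution set of the linear system `f t x ≤ b t`, `t ∈ T`, in a normed space: the feasible
set mapping with the coefficient vectors replaced by continuous linear functionals. -/
def solutionSet (f : C(T, StrongDual ℝ E)) (b : C(T, ℝ)) : Set E := {x | ∀ t, f t x ≤ b t}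

/-- The excess `t ↦ f t x - b t` of the linear system at `x`, positive where `x` violates it. -/
noncomputable def excess (f : C(T, StrongDual ℝ E)) (b : C(T, ℝ)) (x : E) : C(T, ℝ) :=
  ⟨fun t ↦ f t x - b t, by fun_prop⟩

variable [CompactSpace T] {f : C(T, StrongDual ℝ E)} {b : C(T, ℝ)} {x z : E}

/-- The largest violation of a constraint of the linear system at `x`, or `0` if there is none. -/
noncomputable def violation (f : C(T, StrongDual ℝ E)) (b : C(T, ℝ)) (x : E) : ℝ :=
  ‖(excess f b x)⁺‖

theorem violation_nonneg : 0 ≤ violation f b x := norm_nonneg _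

theorem violation_le_iff {c : ℝ} (hc : 0 ≤ c) :
    violation f b x ≤ c ↔ ∀ t, f t x - b t ≤ c := by
  rw [violation, ContinuousMap.norm_le _ hc]
  refine forall_congr' fun t ↦ ?_
  change ‖max (f t x - b t) 0‖ ≤ c ↔ _
  rw [Real.norm_of_nonneg (le_max_right _ _), max_le_iff, and_iff_left hc]

theorem sub_le_violation (t : T) : f t x - b t ≤ violation f b x :=
  (violation_le_iff violation_nonneg).1 le_rfl t

theorem mem_solutionSet_iff_violation_eq_zero : x ∈ solutionSet f b ↔ violation f b x = 0 := by
  rw [← violation_nonneg.ge_iff_eq', violation_le_iff le_rfl]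
  simp [solutionSet]

theorem continuous_violation : Continuous (violation f b) := by
  refine continuous_norm.comp (ContinuousMap.continuous_of_continuous_uncurry _ ?_)
  change Continuous fun p : E × T ↦ max (f p.2 p.1 - b p.2) 0
  fun_prop

theorem infDist_setOf_mem_solutionSet :
    infDist b {c | x ∈ solutionSet f c} = violation f b x := by
  have add_mem : b + (excess f b x)⁺ ∈ {c | x ∈ solutionSet f c} := fun t ↦
    sub_le_iff_le_add'.1 (le_posPart (excess f b x) t)
  refine le_antisymm ((infDist_le_dist_of_mem add_mem).trans_eq ?_)
    ((le_infDist ⟨_, add_mem⟩).2 fun c hc ↦ ?_)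
  · rw [dist_self_add_right, violation]
  · refine (violation_le_iff dist_nonneg).2 fun t ↦ ?_
    calc f t x - b t ≤ c t - b t := by gcongr; exact hc t
      _ ≤ dist (c t) (b t) := le_abs_self _
      _ ≤ dist b c := dist_comm b c ▸ ContinuousMap.dist_apply_le_dist t

theorem isHoffmanConstant_solutionSet_iff {κ : ℝ≥0} :
    IsHoffmanConstant (solutionSet f) κ ↔
      ∀ x b, (solutionSet f b).Nonempty → infDist x (solutionSet f b) ≤ κ * violation f b x := by
  refine forall₂_congr fun x b ↦ imp_congr_right fun hb ↦ ?_
  have hx : {c | x ∈ solutionSet f c}.Nonempty := ⟨excess f 0 x, fun t ↦ by simp [excess]⟩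
  rw [← infDist_setOf_mem_solutionSet, infDist, infDist,
    ← ENNReal.toReal_le_toReal (infEDist_ne_top hb)
      (ENNReal.mul_ne_top ENNReal.coe_ne_top (infEDist_ne_top hx)), ENNReal.toReal_mul,
    ENNReal.coe_toReal]

/-- The indices of the constraints which are violated most at `z`. -/
def activeSet (f : C(T, StrongDual ℝ E)) (b : C(T, ℝ)) (z : E) : Set T :=
  {t | f t z - b t = violation f b z}

theorem isCompact_activeSet : IsCompact (activeSet f b z) :=
  (isClosed_eq (by fun_prop) continuous_const).isCompact

theorem zero_notMem_convexHull_image_activeSet (hb : (solutionSet f b).Nonempty)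
    (hz : 0 < violation f b z) : 0 ∉ convexHull ℝ (f '' activeSet f b z) := by
  obtain ⟨y, hy⟩ := hb
  have convex_halfSpace : Convex ℝ {u : StrongDual ℝ E | u (y - z) < 0} :=
    convex_halfSpace_lt (ContinuousLinearMap.apply ℝ ℝ (y - z)).toLinearMap.isLinear 0
  have image_subset : f '' activeSet f b z ⊆ {u | u (y - z) < 0} := by
    rintro _ ⟨t, ht, rfl⟩
    have hyt : f t y ≤ b t := hy t
    have hzt : f t z - b t = violation f b z := ht
    rw [mem_ofPred_eq, map_sub]
    linarith
  exact fun h0 ↦ by simpa using convexHull_min image_subset convex_halfSpace h0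

theorem exists_violation_add_smul_add_le {w : E} {r : ℝ} (hz : 0 < violation f b z)
    (hw : ∀ t ∈ activeSet f b z, r < f t w) :
    ∃ s > 0, violation f b (z - s • w) + s * r ≤ violation f b z := by
  let slow : Set T := {t | f t w ≤ r}
  have isCompact_slow : IsCompact slow :=
    (isClosed_le (by fun_prop) continuous_const).isCompact
  have eventually_slow : ∀ᶠ s in 𝓝 (0 : ℝ), ∀ t ∈ slow,
      f t z - b t + s * (r - f t w) < violation f b z := by
    refine isCompact_slow.eventually_forall_of_forall_eventually fun t ht ↦ ?_
    have hlt : f t z - b t < violation f b z :=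
      (sub_le_violation t).lt_of_ne fun h ↦ (hw t h).not_ge ht
    have hcont : Continuous fun p : ℝ × T ↦ f p.2 z - b p.2 + p.1 * (r - f p.2 w) := by fun_prop
    exact hcont.continuousAt.eventually_lt_const (by simpa using hlt)
  have eventually_pos : ∀ᶠ s in 𝓝 (0 : ℝ), s * r < violation f b z :=
    (by fun_prop : Continuous fun s : ℝ ↦ s * r).continuousAt.eventually_lt_const (by simpa)
  obtain ⟨s, ⟨hslow, hsr⟩, hs⟩ := ((eventually_slow.and eventually_pos).filter_mono
    nhdsWithin_le_nhds).and (eventually_mem_nhdsWithin (s := Ioi (0 : ℝ))) |>.exists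
  refine ⟨s, hs, le_sub_iff_add_le.1 ((violation_le_iff (sub_nonneg.2 hsr.le)).2 fun t ↦ ?_)⟩
  suffices h : f t z - b t + s * (r - f t w) ≤ violation f b z by
    rw [map_sub, map_smul, smul_eq_mul]
    linarith
  obtain ht | ht := le_or_gt (f t w) r
  · exact (hslow t ht).le
  · have : s * (r - f t w) ≤ 0 := mul_nonpos_of_nonneg_of_nonpos (le_of_lt hs) (by linarith)
    linarith [sub_le_violation (f := f) (b := b) (x := z) t]

theorem exists_ne_mem_descentSet_violation {r s : ℝ} (hr : 0 < r) (hrs : r < s)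
    (hs : ∀ J : Set T, IsCompact J → 0 ∉ convexHull ℝ (f '' J) →
      ∀ u ∈ convexHull ℝ (f '' J), s ≤ ‖u‖)
    (hb : (solutionSet f b).Nonempty) (hz : 0 < violation f b z) :
    ∃ y ≠ z, y ∈ descentSet (violation f b) r z := by
  obtain ⟨w, hw, hlt⟩ := exists_norm_le_one_forall_lt_apply_of_convexHull
    (isCompact_activeSet.image f.continuous) hrs
    (hs _ isCompact_activeSet (zero_notMem_convexHull_image_activeSet hb hz))
  obtain ⟨δ, hδ, hle⟩ := exists_violation_add_smul_add_le hz fun t ht ↦ hlt _ ⟨t, ht, rfl⟩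
  refine ⟨z - δ • w, fun heq ↦ ?_, ?_⟩
  · rw [heq] at hle
    linarith [mul_pos hδ hr]
  · have dist_le : dist z (z - δ • w) ≤ δ := by
      rw [dist_self_sub_right, norm_smul, Real.norm_of_nonneg hδ.le]
      exact mul_le_of_le_one_right hδ.le hw
    calc violation f b (z - δ • w) + r * dist z (z - δ • w)
        ≤ violation f b (z - δ • w) + r * δ := by gcongr
      _ ≤ violation f b z := mul_comm r δ ▸ hle

theorem infDist_solutionSet_le_mul_violation [CompleteSpace E] {κ : ℝ} (hκ : 0 ≤ κ)
    (hJ : ∀ J : Set T, IsCompact J → 0 ∉ convexHull ℝ (f '' J) →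
      ∀ u ∈ convexHull ℝ (f '' J), 1 ≤ κ * ‖u‖)
    (hb : (solutionSet f b).Nonempty) (x : E) :
    infDist x (solutionSet f b) ≤ κ * violation f b x := by
  have of_gt : ∀ κ' > κ, infDist x (solutionSet f b) ≤ κ' * violation f b x := by
    intro κ' hκ'
    obtain ⟨ρ, hκρ, hρκ'⟩ := exists_between hκ'
    have hρ : 0 < ρ := hκ.trans_lt hκρ
    have inv_le_norm : ∀ J : Set T, IsCompact J → 0 ∉ convexHull ℝ (f '' J) →
        ∀ u ∈ convexHull ℝ (f '' J), ρ⁻¹ ≤ ‖u‖ := fun J hJc h0 u hu ↦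
      (inv_le_iff_one_le_mul₀' hρ).2 ((hJ J hJc h0 u hu).trans (by gcongr))
    have hr : 0 < κ'⁻¹ := inv_pos.2 (hρ.trans hρκ')
    obtain ⟨z, hz, hz0⟩ := exists_mem_descentSet_eq_zero continuous_violation.lowerSemicontinuous
      (fun _ ↦ violation_nonneg) hr
      (fun _ ↦ exists_ne_mem_descentSet_violation hr (inv_strictAnti₀ hρ hρκ') inv_le_norm hb) x
    calc infDist x (solutionSet f b) ≤ dist x z :=
          infDist_le_dist_of_mem (mem_solutionSet_iff_violation_eq_zero.2 hz0)
      _ ≤ κ' * violation f b x := (inv_mul_le_iff₀ (hρ.trans hρκ')).1 <| by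
          simpa [descentSet, hz0] using hz
  have hlim : Tendsto (fun κ' ↦ κ' * violation f b x) (𝓝[>] κ) (𝓝 (κ * violation f b x)) :=
    (by fun_prop : Continuous fun κ' ↦ κ' * violation f b x).continuousWithinAt
  exact ge_of_tendsto hlim (eventually_mem_nhdsWithin.mono of_gt)

theorem one_le_mul_norm_of_infDist_solutionSet_le {κ : ℝ} (hκ : 0 ≤ κ)
    (hf : ∀ (x : E) (b : C(T, ℝ)), (solutionSet f b).Nonempty →
      infDist x (solutionSet f b) ≤ κ * violation f b x)
    {J : Set T} (h0 : 0 ∉ convexHull ℝ (f '' J)) {u : StrongDual ℝ E}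
    (hu : u ∈ convexHull ℝ (f '' J)) : 1 ≤ κ * ‖u‖ := by
  obtain ⟨S, hSJ, huS⟩ : ∃ S : Finset (StrongDual ℝ E), ↑S ⊆ f '' J ∧ u ∈ convexHull ℝ ↑S := by
    simpa [convexHull_eq_union_convexHull_finite_subsets (f '' J)] using hu
  obtain ⟨d, hd⟩ := exists_forall_apply_le_neg_one S.finite_toSet
    fun h ↦ h0 (convexHull_mono hSJ h)
  -- The constraints outside `S` are relaxed just enough for `d` to satisfy them.
  let b : C(T, ℝ) := ⟨fun t ↦ max (-1) (f t d), by fun_prop⟩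
  have hdb : d ∈ solutionSet f b := fun t ↦ le_max_right _ _
  have violation_zero_le : violation f b 0 ≤ 1 := (violation_le_iff zero_le_one).2 fun t ↦ by
    simpa [b] using neg_le.1 (le_max_left (-1) (f t d))
  have apply_le_neg_one {x : E} (hx : x ∈ solutionSet f b) : u x ≤ -1 := by
    refine convexHull_min (fun v hv ↦ ?_)
      (convex_halfSpace_le (ContinuousLinearMap.apply ℝ ℝ x).toLinearMap.isLinear (-1)) huS
    obtain ⟨t, -, rfl⟩ := hSJ hv
    exact (hx t).trans (max_le le_rfl (hd _ hv))
  have one_le_norm_mul {x : E} (hx : x ∈ solutionSet f b) : 1 ≤ ‖u‖ * dist 0 x := by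
    rw [dist_zero_left]
    linarith [u.le_opNorm x, neg_le_abs (u x), apply_le_neg_one hx, Real.norm_eq_abs (u x)]
  have hu0 : 0 < ‖u‖ := norm_pos_iff.2 fun h ↦ h0 (h ▸ hu)
  rw [← div_le_iff₀ hu0]
  calc 1 / ‖u‖ ≤ infDist 0 (solutionSet f b) :=
        (le_infDist ⟨d, hdb⟩).2 fun x hx ↦ (div_le_iff₀' hu0).2 (one_le_norm_mul hx)
    _ ≤ κ * violation f b 0 := hf 0 b ⟨d, hdb⟩
    _ ≤ κ := mul_le_of_le_one_right hκ violation_zero_le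

theorem isHoffmanConstant_solutionSet_iff_iSup_le [CompleteSpace E] {κ : ℝ≥0} :
    IsHoffmanConstant (solutionSet f) κ ↔
      ⨆ J : Set T, ⨆ _ : IsCompact J, ⨆ _ : 0 ∉ convexHull ℝ (f '' J),
        (infEDist 0 (convexHull ℝ (f '' J)))⁻¹ ≤ (κ : ℝ≥0∞) := by
  simp only [isHoffmanConstant_solutionSet_iff, iSup_le_iff, inv_infEDist_zero_le_coe_iff]
  exact ⟨fun hf _ _ h0 _ hu ↦ one_le_mul_norm_of_infDist_solutionSet_le κ.coe_nonneg hf h0 hu,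
    fun hJ x _ hb ↦ infDist_solutionSet_le_mul_violation κ.coe_nonneg hJ hb x⟩

end LinearSystem

theorem mainTheorem2_general {E : Type*} [NormedAddCommGroup E] [NormedSpace ℝ E]
    [CompleteSpace E] {T : Type*} [TopologicalSpace T] [CompactSpace T]
    (f : C(T, StrongDual ℝ E)) :
    globalHoffman (solutionSet f) =
      ⨆ J : Set T, ⨆ _ : IsCompact J, ⨆ _ : 0 ∉ convexHull ℝ (f '' J),
        (infEDist 0 (convexHull ℝ (f '' J)))⁻¹ := by
  simp only [globalHoffman, isHoffmanConstant_solutionSet_iff_iSup_le, iInf_coe_of_le_coe]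

namespace RnWith

variable {n : ℕ} (N : RnNorm n)

/-- The coordinates of a vector of `ℝⁿ` with the norm `N`, as a linear equivalence. -/
def coordsEquiv : RnWith N ≃ₗ[ℝ] (Fin n → ℝ) := LinearEquiv.refl ℝ (Fin n → ℝ)

instance : FiniteDimensional ℝ (RnWith N) := (coordsEquiv N).symm.finiteDimensional

instance : CompleteSpace (RnWith N) := FiniteDimensional.complete ℝ (RnWith N)

/-- The identification of a coefficient vector `u` with the functional `x ↦ u'x` on `ℝⁿ` with the
norm `N`; it turns the dual norm into the operator norm. -/
noncomputable def toDual : (Fin n → ℝ) ≃L[ℝ] StrongDual ℝ (RnWith N) :=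
  (dotProductEquiv ℝ (Fin n) ≪≫ₗ (coordsEquiv N).dualMap ≪≫ₗ
    LinearMap.toContinuousLinearMap).toContinuousLinearEquiv

variable {N}

theorem toDual_apply (u : Fin n → ℝ) (x : RnWith N) : toDual N u x = u ⬝ᵥ x.coords := rfl

theorem enorm_toDual (u : Fin n → ℝ) : ‖toDual N u‖ₑ = dualNorm N u := by
  simp only [dualNorm, ← toDual_apply, ← Real.enorm_eq_ofReal_abs]
  refine le_antisymm (ENNReal.le_of_forall_nnreal_lt fun r hr ↦ ?_) (iSup₂_le fun x hx ↦ ?_)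
  · obtain ⟨x, hx, hrx⟩ := (toDual N u).exists_lt_apply_of_lt_opNNNorm (ENNReal.coe_lt_coe.1 hr)
    exact le_iSup₂_of_le x hx.le (ENNReal.coe_le_coe.2 hrx.le)
  · exact ENNReal.coe_le_coe.2 ((toDual N u).unit_le_opNorm x hx)

theorem infEDist_zero_image_toDual (C : Set (Fin n → ℝ)) :
    infEDist 0 (toDual N '' C) = dualDist N 0 C := by
  simp only [infEDist, iInf_image, dualDist, ← enorm_toDual, edist_eq_enorm_sub, map_sub, map_zero]

theorem zero_mem_image_toDual_iff {C : Set (Fin n → ℝ)} : 0 ∈ toDual N '' C ↔ 0 ∈ C := by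
  rw [← map_zero (toDual N), (toDual N).injective.mem_set_image]

theorem convexHull_image_toDual_comp {T : Type*} (a : T → Fin n → ℝ) (J : Set T) :
    convexHull ℝ ((toDual N ∘ a) '' J) = toDual N '' convexHull ℝ (a '' J) := by
  rw [image_comp]
  exact ((toDual N).toLinearMap.image_convexHull (a '' J)).symm

end RnWith

theorem mainTheorem2 {n : ℕ} (N : RnNorm n) {T : Type*} [MetricSpace T] [CompactSpace T]
    (a : T → Fin n → ℝ) (ha : Continuous a) :
    globalHoffman (fun b : C(T, ℝ) => feasibleSet N a b) =
      ⨆ J : Set T, ⨆ _ : IsCompact J, ⨆ _ : (0 : Fin n → ℝ) ∉ convexHull ℝ (a '' J),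
        (dualDist N 0 (convexHull ℝ (a '' J)))⁻¹ := by
  simpa only [ContinuousMap.coe_mk, RnWith.convexHull_image_toDual_comp,
    RnWith.zero_mem_image_toDual_iff, RnWith.infEDist_zero_image_toDual] using!
    mainTheorem2_general ⟨RnWith.toDual N ∘ a, (RnWith.toDual N).continuous.comp ha⟩
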